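/- Privacy games. Fix a data universe $\mathcal X$ with at least two elements. Two databases in $\mathcal X^n$ are neighboring if they differ in at most one entry. A randomized algorithm $\mathcal M$ on $\mathcal X^n$ (with discrete output distributions) is $(\epsilon,\delta)$-differentially private if $\Pr[\mathcal M(\mathbf x)\in S]\le e^{\epsilon}\Pr[\mathcal M(\mathbf x')\in S]+\delta$ for all neighboring $\mathbf x,\mathbf x'$ and all events $S$. In the $k$-round adaptive parameter composition game with bit $b\in\{0,1\}$, an adversary draws random coins $R$, and in each round $i=1,\dots,k$ she chooses, as a function of $R$ and of the previous outcomes $A_1,\dots,A_{i-1}$, neighboring databases $\mathbf x^{i,0},\mathbf x^{i,1}\in\mathcal X^n$, parameters $\epsilon_i,\delta_i\ge 0$, and an $(\epsilon_i,\delta_i)$-differentially private algorithm $\mathcal M_i$; she then receives $A_i=\mathcal M_i(\mathbf x^{i,b})$. Her view is $V^b=(R,A_1,\dots,A_k)$, and $\mathrm{Loss}(v)=\log\big(\Pr[V^0=v]/\Pr[V^1=v]\big)$. For $\delta_g>0$, a function $\mathrm{COMP}_{\delta_g}$ from $\mathbb R_{\ge0}^{2k}$ to the extended reals is a valid privacy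 odometer (for $n$ and $k$) if for every adversary, with probability at most $\delta_g$ over $v\sim V^0$, $$|\mathrm{Loss}(v)|>\mathrm{COMP}_{\delta_g}(\epsilon_1,\delta_1,\dots,\epsilon_k,\delta_k),$$ where $\epsilon_i,\delta_i$ are the parameters realized in $v$. Theorem. There is an absolute constant $\delta_0>0$ with the following property. For each $n$ let $k=k(n)\ge n$ be a number of rounds and $\delta_g=\delta_g(n)\in(0,\delta_0)$ a failure probability with $\log(1/\delta_g)=O(k)$ as $n\to\infty$ (for instance, $k=n$ and $\delta_g$ constant), and let $\mathrm{COMP}_{\delta_g}$ be a function from $\mathbb R_{\ge 0}^{2k}$ to the extended reals such that, for all $\epsilon_1,\dots,\epsilon_k\ge0$, $$\mathrm{COMP}_{\delta_g}(\epsilon_1,0,\dots,\epsilon_k,0)=\sum_{i=1}^k\epsilon_i\left(\frac{e^{\epsilon_i}-1}{e^{\epsilon_i}+1}\right)+o\left(\sqrt{\sum_{i=1}^k\epsilon_i^2\,\log\big(\log(n)/\delta_g\big)}\right),$$ where the remainder is real and the $o(\cdot)$ is as $n\to\infty$, uniformly in $(\epsilon_1,\dots,\epsilon_k)$. Then for all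 sufficiently large $n$, $\mathrm{COMP}_{\delta_g}$ is not a valid privacy odometer. -/

import Mathlib

open Filter Asymptotics
open scoped NNReal ENNReal Topology

noncomputable section

namespace AdaptivePrivacy

/-- Databases `x x' ∈ 𝒳ⁿ` are neighboring: they agree outside some index `i`. -/
def Neighboring {𝒳 : Type*} {n : ℕ} (x x' : Fin n → 𝒳) : Prop :=
  ∃ i, ∀ j, j ≠ i → x j = x' j

/-- `(ε, δ)`-indistinguishability of two (discrete) distributions. The value
`p.toOuterMeasure S` is the probability of the event `S` under `p`. -/
def Indist {𝒴 : Type*} (ε δ : ℝ≥0) (p q : PMF 𝒴) : Prop :=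
  ∀ S : Set 𝒴,
    p.toOuterMeasure S ≤ ENNReal.ofReal (Real.exp ε) * q.toOuterMeasure S + δ ∧
    q.toOuterMeasure S ≤ ENNReal.ofReal (Real.exp ε) * p.toOuterMeasure S + δ

/-- `(ε, δ)`-differential privacy of a randomized algorithm `M : 𝒳ⁿ → 𝒴`. -/
def IsDP {𝒳 𝒴 : Type*} {n : ℕ} (ε δ : ℝ≥0) (M : (Fin n → 𝒳) → PMF 𝒴) : Prop :=
  ∀ x x' : Fin n → 𝒳, Neighboring x x' → Indist ε δ (M x) (M x')

/-- What the adversary submits in one round: two neighboring databases, privacy parameters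
`(ε, δ)`, and an `(ε, δ)`-differentially private algorithm. The database `data false` is the
one used in experiment `b = 0`, and `data true` the one used in experiment `b = 1`. -/
structure Move (𝒳 : Type*) (n : ℕ) (𝒴 : Type*) where
  data : Bool → Fin n → 𝒳
  neighboring : Neighboring (data false) (data true)
  eps : ℝ≥0
  delta : ℝ≥0
  mech : (Fin n → 𝒳) → PMF 𝒴
  dp : IsDP eps delta mech

/-- A randomized adaptive adversary: a distribution of internal coins, and for every value of
the coins and every list of outcomes received so far (in chronological order) the next move.
The range `Out` of the outcomes is arbitrary. -/
structure Adversary (𝒳 : Type*) (n : ℕ) where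
  Coin : Type
  Out : Type
  coins : PMF Coin
  move : Coin → List Out → Move 𝒳 n Out

namespace Adversary

variable {𝒳 : Type*} {n : ℕ} (A : Adversary 𝒳 n)

/-- The distribution of the outcomes of the first `k` rounds of experiment `b`, for fixed
coins `r`. In every round the adversary's move is computed from `r` and the earlier outcomes,
and its algorithm is run on the database that belongs to `b`. -/
def outcomes (b : Bool) (r : A.Coin) : ℕ → PMF (List A.Out)
  | 0 => PMF.pure []
  | k + 1 => (outcomes b r k).bind fun h =>
      ((A.move r h).mech ((A.move r h).data b)).map fun a => h ++ [a]

/-- The view of the adversary in the `k`-round adaptive parameter composition game with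
experiment parameter `b`: her coins together with the outcomes of all rounds. -/
def view (k : ℕ) (b : Bool) : PMF (A.Coin × List A.Out) :=
  A.coins.bind fun r => (A.outcomes b r k).map fun h => (r, h)

/-- The realized privacy parameters `ε₁, …, ε_k` of the view `v`. -/
def epsSeq (k : ℕ) (v : A.Coin × List A.Out) : Fin k → ℝ≥0 :=
  fun i => (A.move v.1 (v.2.take i)).eps

/-- The realized privacy parameters `δ₁, …, δ_k` of the view `v`. -/
def deltaSeq (k : ℕ) (v : A.Coin × List A.Out) : Fin k → ℝ≥0 :=
  fun i => (A.move v.1 (v.2.take i)).delta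

/-- The privacy loss `log (Pr[V⁰ = v] / Pr[V¹ = v])`, which is `+∞` where only the
denominator vanishes. -/
def loss (k : ℕ) (v : A.Coin × List A.Out) : EReal :=
  ENNReal.log (A.view k false v / A.view k true v)

end Adversary

/-- `odom` is a valid privacy odometer for `k` rounds on databases in `𝒳ⁿ` with failure
probability `δg`: against every adversary, with probability at most `δg` over `v ∼ V⁰`,
`|Loss(v)| > odom(ε₁, δ₁, …, ε_k, δ_k)`. -/
def IsValidOdometer (𝒳 : Type*) (n k : ℕ) (δg : ℝ)
    (odom : (Fin k → ℝ≥0) → (Fin k → ℝ≥0) → EReal) : Prop :=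
  ∀ A : Adversary 𝒳 n,
    (A.view k false).toOuterMeasure
        {v | odom (A.epsSeq k v) (A.deltaSeq k v) < ((A.loss k v).abs : EReal)}
      ≤ ENNReal.ofReal δg

end AdaptivePrivacy

end

noncomputable section

namespace AdaptivePrivacy

/-! The adversary exploits stopping at a favourable moment. She runs randomized response in blocks
of N rounds, with tiny parameters that triple from block to block, and plays ε = 0 once a block has
answered only `true`. Let E be the parameter of that block. It contributes NE to the loss, and the
earlier blocks, a geometric series, take back at most NE/2. The sum of the squared parameters is
likewise at most 9/8·NE². The claimed bound is therefore of order NE² + o(E√(N log(log n/δ))), and a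
loss of NE/2 exceeds it as soon as N is at least a small constant times log(log n/δ)
(`le_lossSum_blockEps`, `sum_sq_blockEps_le`, `sum_add_lt_lossSum`).

In experiment 0 each block is such a run with conditional probability at least 2⁻ᴺ, so m blocks
without a run have probability at most (1 - 2⁻ᴺ)ᵐ (`toOuterMeasure_noRun_le`). For N = a log(log
n/δ) with a small, 2⁻ᴺ is so large that the m blocks fitting into k rounds contain a run with
probability above δ (`exists_block_params`). -/

/-! ### Randomized response and its privacy -/

/-- The probability that randomized response with bias `s` answers `a`. -/
def responseWeight (s : ℝ) (a : Bool) : ℝ :=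
  1 / (1 + Real.exp (if a then -s else s))

theorem responseWeight_pos (s : ℝ) (a : Bool) : 0 < responseWeight s a := by
  unfold responseWeight; positivity

theorem responseWeight_add (s : ℝ) : responseWeight s true + responseWeight s false = 1 := by
  have h : Real.exp s ≠ 0 := (Real.exp_pos s).ne'
  have h' : 1 + Real.exp s ≠ 0 := by positivity
  have h'' : Real.exp s + 1 ≠ 0 := by positivity
  simp only [responseWeight, if_true, Bool.false_eq_true, if_false, Real.exp_neg]
  field_simp
  ring

/-- Randomized response with bias `s`: the answer `true` has odds `exp s`. -/
def randomizedResponse (s : ℝ) : PMF Bool :=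
  PMF.ofFintype (fun a => ENNReal.ofReal (responseWeight s a)) (by
    rw [Fintype.sum_bool, ← ENNReal.ofReal_add (responseWeight_pos _ _).le
      (responseWeight_pos _ _).le, responseWeight_add, ENNReal.ofReal_one])

theorem randomizedResponse_apply (s : ℝ) (a : Bool) :
    randomizedResponse s a = ENNReal.ofReal (responseWeight s a) := rfl

theorem responseWeight_le {s s' ε : ℝ} (hs : |s| ≤ ε) (hs' : |s'| ≤ ε) (a : Bool) :
    responseWeight s a ≤ Real.exp ε * responseWeight s' a := by
  have key : ∀ x y : ℝ, |x| ≤ ε → |y| ≤ ε →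
      1 / (1 + Real.exp x) ≤ Real.exp ε * (1 / (1 + Real.exp y)) := by
    intro x y hx hy
    rw [mul_one_div, div_le_div_iff₀ (by positivity) (by positivity)]
    have h1 : Real.exp y ≤ Real.exp ε := Real.exp_le_exp.2 (abs_le.1 hy).2
    have h2 : 1 ≤ Real.exp (ε + x) := Real.one_le_exp (by linarith [(abs_le.1 hx).1])
    rw [Real.exp_add] at h2
    linarith
  cases a
  · simpa [responseWeight] using key s s' hs hs'
  · simpa [responseWeight] using key (-s) (-s') (by simpa using hs) (by simpa using hs')

theorem toOuterMeasure_le_mul {α : Type*} {p q : PMF α} {c : ℝ≥0∞} (h : ∀ a, p a ≤ c * q a)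
    (S : Set α) : p.toOuterMeasure S ≤ c * q.toOuterMeasure S := by
  rw [PMF.toOuterMeasure_apply, PMF.toOuterMeasure_apply, ← ENNReal.tsum_mul_left]
  refine ENNReal.tsum_le_tsum fun a => ?_
  by_cases ha : a ∈ S <;> simp [ha, h a]

theorem indist_randomizedResponse {s s' : ℝ} {ε : ℝ≥0} (hs : |s| ≤ ε) (hs' : |s'| ≤ ε) :
    Indist ε 0 (randomizedResponse s) (randomizedResponse s') := by
  have key : ∀ {s s' : ℝ}, |s| ≤ ε → |s'| ≤ ε → ∀ a, randomizedResponse s a ≤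
      ENNReal.ofReal (Real.exp ε) * randomizedResponse s' a := by
    intro s s' hs hs' a
    rw [randomizedResponse_apply, randomizedResponse_apply,
      ← ENNReal.ofReal_mul (Real.exp_pos _).le]
    exact ENNReal.ofReal_le_ofReal (responseWeight_le hs hs' a)
  intro S
  simp only [ENNReal.coe_zero, add_zero]
  exact ⟨toOuterMeasure_le_mul (key hs hs') S, toOuterMeasure_le_mul (key hs' hs) S⟩

/-- The two experiments use opposite biases, so one answer contributes exactly ±s to the privacy
loss. -/
theorem responseWeight_eq_exp_mul (s : ℝ) (a : Bool) :
    responseWeight s a = Real.exp ((if a then 1 else -1) * s) * responseWeight (-s) a := by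
  have h : Real.exp s ≠ 0 := (Real.exp_pos s).ne'
  have h' : 1 + Real.exp s ≠ 0 := by positivity
  have h'' : Real.exp s + 1 ≠ 0 := by positivity
  cases a <;> simp [responseWeight, Real.exp_neg] <;> field_simp <;> ring

/-- The bias only helps in experiment 0: this bound holds whatever parameter was chosen adaptively,
so no independence of the rounds is needed later. -/
theorem half_le_responseWeight {s : ℝ} (hs : 0 ≤ s) : 1 / 2 ≤ responseWeight s true := by
  have : Real.exp (-s) ≤ 1 := Real.exp_le_one_iff.2 (by linarith)
  simp only [responseWeight, if_true]
  exact one_div_le_one_div_of_le (by positivity) (by linarith)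

/-! ### The adversary's view and her loss -/

/-- The adversary who in every round asks for the presence of `x₀` in entry `i₀` by randomized
response, with the privacy parameter `e h` after the outcomes `h`. -/
def responseAdversary {𝒳 : Type*} {n : ℕ} (i₀ : Fin n) (x₀ x₁ : 𝒳) (e : List Bool → ℝ≥0) :
    Adversary 𝒳 n where
  Coin := Unit
  Out := Bool
  coins := PMF.pure ()
  move := fun _ h =>
    { data := fun b => Function.update (fun _ => x₀) i₀ (if b then x₁ else x₀)
      neighboring := ⟨i₀, fun j hj => by simp [hj]⟩
      eps := e h
      delta := 0
      mech := fun x => open Classical in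
        randomizedResponse (if x i₀ = x₀ then (e h : ℝ) else -(e h : ℝ))
      dp := fun x x' _ => indist_randomizedResponse
        (by split_ifs <;> simp) (by split_ifs <;> simp) }

/-- The sequence of the first `k` answers of randomized response, with the bias `e h`
(negated if `b`) after the answers `h`. -/
def responses (e : List Bool → ℝ≥0) (b : Bool) : ℕ → PMF (List Bool)
  | 0 => PMF.pure []
  | k + 1 => (responses e b k).bind fun h =>
      (randomizedResponse (if b then -(e h : ℝ) else e h)).map fun a => h ++ [a]

theorem outcomes_responseAdversary {𝒳 : Type*} {n : ℕ} (i₀ : Fin n) {x₀ x₁ : 𝒳} (hx : x₁ ≠ x₀)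
    (e : List Bool → ℝ≥0) (b : Bool) (k : ℕ) :
    (responseAdversary i₀ x₀ x₁ e).outcomes b () k = responses e b k := by
  induction k with
  | zero => rfl
  | succ k ih =>
    refine congrArg₂ PMF.bind ih (funext fun h => ?_)
    cases b <;> simp [responseAdversary, hx] <;> rfl

theorem view_responseAdversary {𝒳 : Type*} {n : ℕ} (i₀ : Fin n) {x₀ x₁ : 𝒳} (hx : x₁ ≠ x₀)
    (e : List Bool → ℝ≥0) (b : Bool) (k : ℕ) :
    (responseAdversary i₀ x₀ x₁ e).view k b = (responses e b k).map fun h => ((), h) := by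
  rw [Adversary.view, ← outcomes_responseAdversary i₀ hx e b k]
  exact PMF.pure_bind _ _

theorem view_responseAdversary_apply {𝒳 : Type*} {n : ℕ} (i₀ : Fin n) {x₀ x₁ : 𝒳} (hx : x₁ ≠ x₀)
    (e : List Bool → ℝ≥0) (b : Bool) (k : ℕ) (h : List Bool) :
    (responseAdversary i₀ x₀ x₁ e).view k b ((), h) = responses e b k h := by
  rw [view_responseAdversary i₀ hx]
  refine (PMF.map_apply _ _ _).trans ?_
  rw [tsum_eq_single h]
  · exact if_pos rfl
  · intro h' hh'
    exact if_neg fun heq => hh' (congrArg Prod.snd heq).symm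

theorem toOuterMeasure_responses_succ (e : List Bool → ℝ≥0) (b : Bool) (k : ℕ)
    (S : Set (List Bool)) :
    (responses e b (k + 1)).toOuterMeasure S = ∑' h, responses e b k h *
      (randomizedResponse (if b then -(e h : ℝ) else e h)).toOuterMeasure
        {a | h ++ [a] ∈ S} := by
  rw [responses, PMF.toOuterMeasure_bind_apply]
  simp only [PMF.toOuterMeasure_map_apply]
  rfl

theorem responses_succ_append (e : List Bool → ℝ≥0) (b : Bool) (k : ℕ) (h : List Bool)
    (a : Bool) : responses e b (k + 1) (h ++ [a]) =
      responses e b k h * randomizedResponse (if b then -(e h : ℝ) else e h) a := by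
  rw [← PMF.toOuterMeasure_apply_singleton, toOuterMeasure_responses_succ,
    tsum_eq_single h]
  · congr 1
    rw [← PMF.toOuterMeasure_apply_singleton]
    congr 1
    ext a'
    simp
  · intro h' hh'
    have : {a' | h' ++ [a'] ∈ ({h ++ [a]} : Set (List Bool))} = ∅ := by
      ext a'
      simpa using fun hh => absurd hh hh'
    rw [this]
    simp

theorem length_of_responses_ne_zero {e : List Bool → ℝ≥0} {b : Bool} {k : ℕ} {h : List Bool}
    (hh : responses e b k h ≠ 0) : h.length = k := by
  induction k generalizing h with
  | zero =>
    have : h = [] := by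
      by_contra hne
      exact hh (by simp [responses, hne])
    simp [this]
  | succ k ih =>
    rw [← PMF.mem_support_iff, responses, PMF.mem_support_bind_iff] at hh
    obtain ⟨h', hh', hmem⟩ := hh
    rw [PMF.mem_support_map_iff] at hmem
    obtain ⟨a, -, rfl⟩ := hmem
    simp [ih hh']

/-- The privacy loss accumulated by the first `k` answers in `h`. -/
def lossSum (e : List Bool → ℝ≥0) (k : ℕ) (h : List Bool) : ℝ :=
  ∑ i ∈ Finset.range k, (if h.getD i false then 1 else -1) * (e (h.take i) : ℝ)

theorem lossSum_succ_append (e : List Bool → ℝ≥0) {k : ℕ} {h : List Bool} (hk : h.length = k)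
    (a : Bool) :
    lossSum e (k + 1) (h ++ [a]) = lossSum e k h + (if a then 1 else -1) * (e h : ℝ) := by
  subst hk
  rw [lossSum, Finset.sum_range_succ]
  congr 1
  · refine Finset.sum_congr rfl fun i hi => ?_
    have hi := Finset.mem_range.1 hi
    rw [List.take_append_of_le_length hi.le, List.getD_append _ _ _ _ hi]
  · simp

/-- Likelihood ratios multiply over the rounds. Positivity keeps the quotient in `loss` finite. -/
theorem responses_pos_and_eq (e : List Bool → ℝ≥0) {k : ℕ} {h : List Bool} (hk : h.length = k) :
    responses e true k h ≠ 0 ∧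
      responses e false k h = ENNReal.ofReal (Real.exp (lossSum e k h)) * responses e true k h := by
  induction k generalizing h with
  | zero =>
    rw [List.length_eq_zero_iff] at hk
    subst hk
    simp [responses, lossSum]
  | succ k ih =>
    obtain ⟨h', a, rfl⟩ : ∃ h' a, h = h' ++ [a] :=
      ⟨_, _, (List.dropLast_append_getLast (List.ne_nil_of_length_eq_add_one hk)).symm⟩
    have hk' : h'.length = k := by simpa using hk
    obtain ⟨h1, h2⟩ := ih hk'
    have hw : randomizedResponse (e h') a = ENNReal.ofReal (Real.exp
        ((if a then 1 else -1) * (e h' : ℝ))) * randomizedResponse (-(e h' : ℝ)) a := by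
      rw [randomizedResponse_apply, randomizedResponse_apply,
        ← ENNReal.ofReal_mul (Real.exp_pos _).le, ← responseWeight_eq_exp_mul]
    rw [responses_succ_append, responses_succ_append, lossSum_succ_append e hk', Real.exp_add,
      ENNReal.ofReal_mul (Real.exp_pos _).le, h2]
    simp only [Bool.false_eq_true, if_true, if_false]
    rw [hw]
    refine ⟨mul_ne_zero h1 ?_, by ring⟩
    rw [randomizedResponse_apply]
    simpa using responseWeight_pos _ _

theorem loss_responseAdversary {𝒳 : Type*} {n : ℕ} (i₀ : Fin n) {x₀ x₁ : 𝒳} (hx : x₁ ≠ x₀)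
    (e : List Bool → ℝ≥0) {k : ℕ} {h : List Bool} (hk : h.length = k) :
    (responseAdversary i₀ x₀ x₁ e).loss k ((), h) = ((lossSum e k h : ℝ) : EReal) := by
  obtain ⟨h1, h2⟩ := responses_pos_and_eq e hk
  rw [Adversary.loss, view_responseAdversary_apply i₀ hx, view_responseAdversary_apply i₀ hx, h2,
    ENNReal.mul_div_cancel_right h1 (PMF.apply_ne_top _ _),
    ENNReal.log_ofReal_of_pos (Real.exp_pos _), Real.log_exp]

/-! ### Probability of a run -/

theorem toOuterMeasure_union_of_disjoint {α : Type*} (p : PMF α) {S T : Set α}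
    (h : Disjoint S T) :
    p.toOuterMeasure (S ∪ T) = p.toOuterMeasure S + p.toOuterMeasure T := by
  simp only [PMF.toOuterMeasure_apply]
  rw [Set.indicator_union_of_disjoint h, ← ENNReal.tsum_add]

theorem toOuterMeasure_univ {α : Type*} (p : PMF α) : p.toOuterMeasure Set.univ = 1 :=
  (p.toOuterMeasure_apply_eq_one_iff _).2 (Set.subset_univ _)

/-- Later rounds do not change the law of a prefix. -/
theorem toOuterMeasure_responses_take (e : List Bool → ℝ≥0) (b : Bool) (t s : ℕ)
    (F : Set (List Bool)) :
    (responses e b (t + s)).toOuterMeasure {h | h.take t ∈ F} =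
      (responses e b t).toOuterMeasure F := by
  induction s with
  | zero =>
    refine PMF.toOuterMeasure_apply_eq_of_inter_support_eq _ ?_
    ext h
    simp only [Set.mem_inter_iff, Set.mem_ofPred_eq, PMF.mem_support_iff, add_zero]
    refine and_congr_left fun hh => ?_
    rw [List.take_of_length_le (length_of_responses_ne_zero hh).le]
  | succ s ih =>
    rw [← ih, ← add_assoc, toOuterMeasure_responses_succ, PMF.toOuterMeasure_apply]
    refine tsum_congr fun h => ?_
    by_cases h0 : responses e b (t + s) h = 0
    · rw [h0, zero_mul]
      exact (Set.indicator_apply_eq_zero.2 fun _ => h0).symm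
    have hlen := length_of_responses_ne_zero h0
    have : ∀ a, (h ++ [a]).take t = h.take t := fun a =>
      List.take_append_of_le_length (by omega)
    by_cases hF : h.take t ∈ F
    · have hm : h ∈ {h : List Bool | h.take t ∈ F} := hF
      have h1 : {a | h ++ [a] ∈ {h : List Bool | h.take t ∈ F}} = Set.univ := by
        ext a; simp [this, hF]
      rw [h1, toOuterMeasure_univ, Set.indicator_of_mem hm, mul_one]
    · have hm : h ∉ {h : List Bool | h.take t ∈ F} := hF
      have h1 : {a | h ++ [a] ∈ {h : List Bool | h.take t ∈ F}} = ∅ := by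
        ext a; simp [this, hF]
      rw [h1, Set.indicator_of_notMem hm]
      simp

theorem toOuterMeasure_responses_append_true (e : List Bool → ℝ≥0) (k : ℕ)
    {F G : Set (List Bool)} (h : ∀ l ∈ F, l ++ [true] ∈ G) :
    2⁻¹ * (responses e false k).toOuterMeasure F ≤
      (responses e false (k + 1)).toOuterMeasure G := by
  rw [toOuterMeasure_responses_succ, PMF.toOuterMeasure_apply, ← ENNReal.tsum_mul_left]
  refine ENNReal.tsum_le_tsum fun l => ?_
  by_cases hl : l ∈ F
  · rw [Set.indicator_of_mem hl, mul_comm]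
    refine mul_le_mul_right (le_trans ?_ (PMF.toOuterMeasure_mono (s := {true}) _
      (Set.inter_subset_left.trans (Set.singleton_subset_iff.2 (h l hl))))) _
    rw [PMF.toOuterMeasure_apply_singleton, randomizedResponse_apply]
    have := ENNReal.ofReal_le_ofReal (half_le_responseWeight (e l).2)
    refine le_trans (le_of_eq ?_) this
    rw [one_div, ENNReal.ofReal_inv_of_pos two_pos]
    norm_num
  · simp [hl]

/-- The length is part of the event so that the induction can control `take` and `drop` of the
extended list. -/
theorem toOuterMeasure_responses_replicate (e : List Bool → ℝ≥0) (t s : ℕ)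
    (F : Set (List Bool)) :
    2⁻¹ ^ s * (responses e false t).toOuterMeasure F ≤
      (responses e false (t + s)).toOuterMeasure
        {h | h.take t ∈ F ∧ h.drop t = List.replicate s true ∧ h.length = t + s} := by
  induction s with
  | zero =>
    rw [pow_zero, one_mul, add_zero]
    refine PMF.toOuterMeasure_mono _ ?_
    rintro h ⟨hF, hh⟩
    have hlen := length_of_responses_ne_zero hh
    exact ⟨by rwa [List.take_of_length_le hlen.le], by simp [hlen], hlen⟩
  | succ s ih =>
    rw [pow_succ', mul_assoc]
    refine (mul_le_mul_right ih _).trans ?_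
    refine toOuterMeasure_responses_append_true e (t + s) ?_
    rintro l ⟨hl, hl', hlen⟩
    refine ⟨?_, ?_, by simp [hlen, add_assoc]⟩
    · rwa [List.take_append_of_le_length (by omega)]
    · rw [List.drop_append_of_le_length (by omega), hl', List.replicate_succ']

/-- The lists none of whose first `j` blocks of length `N` consists of `true` only. -/
def noRun (N j : ℕ) : Set (List Bool) :=
  {h | ∀ i < j, (h.drop (i * N)).take N ≠ List.replicate N true}

theorem take_drop_take {α : Type*} (h : List α) {i N t : ℕ} (ht : i * N + N ≤ t) :
    ((h.take t).drop (i * N)).take N = (h.drop (i * N)).take N := by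
  rw [List.drop_take, List.take_take, min_eq_left (by omega)]

theorem take_mem_noRun {N j t : ℕ} (ht : j * N ≤ t) (h : List Bool) :
    h.take t ∈ noRun N j ↔ h ∈ noRun N j := by
  refine forall₂_congr fun i hi => ?_
  rw [take_drop_take]
  calc i * N + N = (i + 1) * N := by ring
    _ ≤ j * N := Nat.mul_le_mul_right _ hi
    _ ≤ t := ht

theorem toOuterMeasure_noRun_le (e : List Bool → ℝ≥0) (N j : ℕ) :
    (responses e false (j * N)).toOuterMeasure (noRun N j) ≤ (1 - 2⁻¹ ^ N) ^ j := by
  induction j with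
  | zero =>
    rw [pow_zero, ← toOuterMeasure_univ (responses e false (0 * N))]
    exact PMF.toOuterMeasure_mono _ (fun _ _ => Set.mem_univ _)
  | succ j ih =>
    set p := responses e false (j * N)
    set p' := responses e false (j * N + N) with hp'
    set R : Set (List Bool) := {h | h.take (j * N) ∈ noRun N j ∧
      h.drop (j * N) = List.replicate N true ∧ h.length = j * N + N} with hR
    have hdisj : Disjoint (noRun N (j + 1)) R := by
      rw [Set.disjoint_left]
      rintro h h1 ⟨-, h2, -⟩
      exact h1 j (Nat.lt_succ_self j) (by rw [h2]; simp)
    -- Both events refine the absence of a run in the first j blocks, which depends only on the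
    -- prefix. The run in block j takes away at least a fraction 2⁻ᴺ of its mass.
    have hsub : p'.toOuterMeasure (noRun N (j + 1)) + p'.toOuterMeasure R ≤
        p.toOuterMeasure (noRun N j) := by
      rw [← toOuterMeasure_union_of_disjoint _ hdisj,
        ← toOuterMeasure_responses_take e false (j * N) N]
      refine PMF.toOuterMeasure_mono _ (Set.inter_subset_left.trans ?_)
      rintro h (hh | hh)
      · exact (take_mem_noRun le_rfl h).2 fun i hi => hh i (by omega)
      · exact hh.1
    have hq : 2⁻¹ ^ N * p.toOuterMeasure (noRun N j) ≤ p'.toOuterMeasure R :=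
      toOuterMeasure_responses_replicate e (j * N) N (noRun N j)
    have hfin : p.toOuterMeasure (noRun N j) ≠ ∞ :=
      ne_top_of_le_ne_top ENNReal.one_ne_top (by
        rw [← toOuterMeasure_univ p]
        exact PMF.toOuterMeasure_mono _ (fun _ _ => Set.mem_univ _))
    have h2 : (2⁻¹ : ℝ≥0∞) ^ N ≠ ∞ := ENNReal.pow_ne_top (by simp)
    have : (j + 1) * N = j * N + N := by ring
    rw [this, pow_succ', ← hp']
    calc p'.toOuterMeasure (noRun N (j + 1))
        ≤ p.toOuterMeasure (noRun N j) - 2⁻¹ ^ N * p.toOuterMeasure (noRun N j) :=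
          ENNReal.le_sub_of_add_le_right (ENNReal.mul_ne_top h2 hfin)
            ((add_le_add_right hq _).trans hsub)
      _ = (1 - 2⁻¹ ^ N) * p.toOuterMeasure (noRun N j) := by
          rw [ENNReal.sub_mul (fun _ _ => hfin), one_mul]
      _ ≤ _ := mul_le_mul_right ih _

/-! ### The tripling strategy: loss against the claimed bound -/

/-- The privacy parameters of an adversary who triples them after each block of length `N` and
stops after the first block whose answers are all `true`. -/
def blockEps (N k : ℕ) (h : List Bool) : ℝ≥0 :=
  open Classical in
  if ∀ j, h ∈ noRun N j then 3 ^ (h.length / N) / 3 ^ (k + 2) else 0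

theorem blockEps_take {N j : ℕ} (hN : 0 < N) {h : List Bool} (hj : h ∈ noRun N j)
    (hrun : (h.drop (j * N)).take N = List.replicate N true) {i : ℕ} (hi : i ≤ h.length) :
    blockEps N h.length (h.take i) =
      if i < (j + 1) * N then 3 ^ (i / N) / 3 ^ (h.length + 2) else 0 := by
  have hsucc : (j + 1) * N = j * N + N := by ring
  classical
  unfold blockEps
  rw [List.length_take, min_eq_left hi]
  refine if_congr ⟨fun hh => ?_, fun hh l a _ hrun' => ?_⟩ rfl rfl
  · by_contra hlt
    exact hh (j + 1) j (Nat.lt_succ_self j) (by rw [take_drop_take _ (by omega), hrun])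
  -- A truncated block is shorter than N, so a run seen in a prefix is a complete block inside that
  -- prefix.
  · have hlen := congrArg List.length hrun'
    simp only [List.length_take, List.length_drop, List.length_replicate] at hlen
    have hai : a * N + N ≤ i := by omega
    rw [take_drop_take _ hai] at hrun'
    refine hj a ?_ hrun'
    have : (a + 1) * N < (j + 1) * N := by rw [add_mul a, one_mul]; omega
    have := Nat.lt_of_mul_lt_mul_right this
    omega

theorem getD_of_run {N t i : ℕ} {h : List Bool}
    (hrun : (h.drop t).take N = List.replicate N true) (hi : i < N) :
    h.getD (t + i) false = true := by
  have h1 := congrArg (fun l => l[i]?) hrun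
  simp only [List.getElem?_take, hi, if_true, List.getElem?_drop, List.getElem?_replicate] at h1
  rw [List.getD_eq_getElem?_getD, h1]
  rfl

theorem sum_range_mul_div {N : ℕ} (hN : 0 < N) (f : ℕ → ℝ) (j : ℕ) :
    ∑ i ∈ Finset.range (j * N), f (i / N) = N * ∑ l ∈ Finset.range j, f l := by
  induction j with
  | zero => simp
  | succ j ih =>
    rw [add_mul, one_mul, Finset.sum_range_add, ih, Finset.sum_range_succ, mul_add]
    congr 1
    rw [Finset.sum_congr rfl (g := fun _ => f j)]
    · simp
    · intro x hx
      rw [mul_comm j, Nat.mul_add_div hN, Nat.div_eq_of_lt (Finset.mem_range.1 hx), add_zero]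

theorem sum_range_blockEps_take {N j : ℕ} (hN : 0 < N) {h : List Bool} (hj : h ∈ noRun N j)
    (hrun : (h.drop (j * N)).take N = List.replicate N true) (hlen : (j + 1) * N ≤ h.length)
    (g : ℕ → ℝ → ℝ) (hg : ∀ i, g i 0 = 0) :
    ∑ i ∈ Finset.range h.length, g i (blockEps N h.length (h.take i)) =
      ∑ i ∈ Finset.range ((j + 1) * N), g i (3 ^ (i / N) / 3 ^ (h.length + 2)) := by
  rw [← Finset.sum_subset (Finset.range_mono hlen)]
  · refine Finset.sum_congr rfl fun i hi => ?_
    have hi := Finset.mem_range.1 hi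
    rw [blockEps_take hN hj hrun (by omega), if_pos hi]
    simp
  · intro i hi hi'
    have hi := Finset.mem_range.1 hi
    rw [Finset.mem_range] at hi'
    rw [blockEps_take hN hj hrun hi.le, if_neg hi']
    simp [hg]

/-- In the worst case every earlier answer is `false`; since 1 + 3 + … + 3^(j-1) < 3^j/2, this
cancels at most half of the final block. -/
theorem le_lossSum_blockEps {N j : ℕ} (hN : 0 < N) {h : List Bool} (hj : h ∈ noRun N j)
    (hrun : (h.drop (j * N)).take N = List.replicate N true) (hlen : (j + 1) * N ≤ h.length) :
    N * (3 ^ j / 3 ^ (h.length + 2) : ℝ) / 2 ≤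
      lossSum (blockEps N h.length) h.length h := by
  set b : ℝ := 3 ^ (h.length + 2)
  have hb : 0 < b := by positivity
  rw [lossSum, sum_range_blockEps_take hN hj hrun hlen
    (fun i x => (if h.getD i false then 1 else -1) * x) (by simp), add_mul, one_mul,
    Finset.sum_range_add]
  have h1 : -(N * ∑ l ∈ Finset.range j, (3 : ℝ) ^ l / b) ≤ ∑ i ∈ Finset.range (j * N),
      (if h.getD i false then 1 else -1) * ((3 : ℝ) ^ (i / N) / b) := by
    rw [← sum_range_mul_div hN (fun l => (3 : ℝ) ^ l / b), ← Finset.sum_neg_distrib]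
    refine Finset.sum_le_sum fun i _ => ?_
    have : 0 < (3 : ℝ) ^ (i / N) / b := by positivity
    split_ifs <;> linarith
  have h2 : ∑ i ∈ Finset.range N, (if h.getD (j * N + i) false then 1 else -1) *
      ((3 : ℝ) ^ ((j * N + i) / N) / b) = N * (3 ^ j / b) := by
    rw [Finset.sum_congr rfl (g := fun _ => (3 : ℝ) ^ j / b)]
    · simp
    · intro i hi
      have hi := Finset.mem_range.1 hi
      rw [getD_of_run hrun hi, mul_comm j, Nat.mul_add_div hN, Nat.div_eq_of_lt hi]
      simp
  rw [h2]
  have h3 : ∑ l ∈ Finset.range j, (3 : ℝ) ^ l / b ≤ (3 ^ j / b) / 2 := by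
    rw [← Finset.sum_div, geom_sum_eq (by norm_num), div_div, div_div, mul_comm b,
      div_le_div_iff₀ (by positivity) (by positivity)]
    nlinarith
  have h4 : (N : ℝ) * ∑ l ∈ Finset.range j, (3 : ℝ) ^ l / b ≤ N * ((3 ^ j / b) / 2) :=
    mul_le_mul_of_nonneg_left h3 (Nat.cast_nonneg N)
  linarith

theorem sum_sq_blockEps_le {N j : ℕ} (hN : 0 < N) {h : List Bool} (hj : h ∈ noRun N j)
    (hrun : (h.drop (j * N)).take N = List.replicate N true) (hlen : (j + 1) * N ≤ h.length) :
    ∑ i ∈ Finset.range h.length, (blockEps N h.length (h.take i) : ℝ) ^ 2 ≤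
      9 / 8 * (N * (3 ^ j / 3 ^ (h.length + 2) : ℝ) ^ 2) := by
  set b : ℝ := 3 ^ (h.length + 2)
  have hb : 0 < b := by positivity
  rw [sum_range_blockEps_take hN hj hrun hlen (fun _ x => x ^ 2) (by simp),
    sum_range_mul_div hN (fun l => ((3 : ℝ) ^ l / b) ^ 2)]
  have h3 : ∑ l ∈ Finset.range (j + 1), ((3 : ℝ) ^ l / b) ^ 2 ≤ 9 / 8 * (3 ^ j / b) ^ 2 := by
    have : ∀ l : ℕ, ((3 : ℝ) ^ l / b) ^ 2 = 9 ^ l / b ^ 2 := fun l => by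
      rw [div_pow, ← pow_mul, mul_comm, pow_mul]; norm_num
    simp only [this]
    rw [← Finset.sum_div, geom_sum_eq (by norm_num), ← mul_div_assoc]
    refine div_le_div_of_nonneg_right ?_ (by positivity)
    rw [pow_succ]
    linarith
  calc _ ≤ N * (9 / 8 * (3 ^ j / b : ℝ) ^ 2) := mul_le_mul_of_nonneg_left h3 (Nat.cast_nonneg N)
    _ = _ := by ring

/-- From 1 - e⁻ˣ ≤ x. The drift term is thus quadratic, hence negligible for small parameters. -/
theorem mul_tanh_half_le {x : ℝ} (hx : 0 ≤ x) :
    x * ((Real.exp x - 1) / (Real.exp x + 1)) ≤ x ^ 2 := by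
  rw [sq]
  refine mul_le_mul_of_nonneg_left ?_ hx
  have h0 := Real.exp_pos x
  have h1 : 1 - x ≤ Real.exp (-x) := by linarith [Real.add_one_le_exp (-x)]
  have h2 := mul_le_mul_of_nonneg_left h1 h0.le
  rw [← Real.exp_add, add_neg_cancel, Real.exp_zero] at h2
  rw [div_le_iff₀ (by positivity)]
  linarith

/-- With E the parameter of the last active block, the drift is at most NE/8 and the square-root
term is below 3NE/8; together they stay below the loss NE/2. -/
theorem sum_add_lt_lossSum {N j : ℕ} (hN : 0 < N) {h : List Bool} (hj : h ∈ noRun N j)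
    (hrun : (h.drop (j * N)).take N = List.replicate N true) (hlen : (j + 1) * N ≤ h.length)
    {c L : ℝ} (hc : 0 ≤ c) (hL : 0 ≤ L) (hcL : 8 * c ^ 2 * L < N) :
    ∑ i ∈ Finset.range h.length, (blockEps N h.length (h.take i) : ℝ) *
        ((Real.exp (blockEps N h.length (h.take i)) - 1) /
          (Real.exp (blockEps N h.length (h.take i)) + 1)) +
      c * √((∑ i ∈ Finset.range h.length, (blockEps N h.length (h.take i) : ℝ) ^ 2) * L) <
      lossSum (blockEps N h.length) h.length h := by
  have h1 := le_lossSum_blockEps hN hj hrun hlen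
  have h2 := sum_sq_blockEps_le hN hj hrun hlen
  have h3 : ∑ i ∈ Finset.range h.length, (blockEps N h.length (h.take i) : ℝ) *
        ((Real.exp (blockEps N h.length (h.take i)) - 1) /
          (Real.exp (blockEps N h.length (h.take i)) + 1)) ≤
      ∑ i ∈ Finset.range h.length, (blockEps N h.length (h.take i) : ℝ) ^ 2 :=
    Finset.sum_le_sum fun i _ => mul_tanh_half_le (NNReal.coe_nonneg _)
  set S := ∑ i ∈ Finset.range h.length, (blockEps N h.length (h.take i) : ℝ) ^ 2
  set E : ℝ := 3 ^ j / 3 ^ (h.length + 2)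
  have hE : 0 < E := by positivity
  -- The normalization by 3^(k+2) serves here: 9/8·NE² ≤ NE/8.
  have hE' : E ≤ 1 / 9 := by
    have hjk : j ≤ h.length := by nlinarith
    rw [div_le_div_iff₀ (by positivity) (by norm_num), pow_add]
    have : (3 : ℝ) ^ j ≤ 3 ^ h.length := pow_le_pow_right₀ (by norm_num) hjk
    linarith
  have hN' : (0 : ℝ) < N := Nat.cast_pos.2 hN
  have h4 : c * √(S * L) < 3 / 8 * (N * E) := by
    have : c * √(S * L) = √(c ^ 2 * (S * L)) := by
      rw [Real.sqrt_mul (sq_nonneg c), Real.sqrt_sq hc]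
    rw [this, Real.sqrt_lt' (by positivity)]
    calc c ^ 2 * (S * L) = (c ^ 2 * L) * S := by ring
      _ ≤ (c ^ 2 * L) * (9 / 8 * (N * E ^ 2)) := mul_le_mul_of_nonneg_left h2 (by positivity)
      _ < (N / 8) * (9 / 8 * (N * E ^ 2)) := by
          refine mul_lt_mul_of_pos_right (by linarith) (by positivity)
      _ = _ := by ring
  have h5 : N * E * E ≤ N * E * (1 / 9) := mul_le_mul_of_nonneg_left hE' (by positivity)
  have h6 : N * E * E = N * E ^ 2 := by ring
  linarith

/-! ### Refuting the odometer -/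

theorem not_isValidOdometer_of_run {𝒳 : Type*} [Nontrivial 𝒳] {n k N m : ℕ} (hn : 0 < n)
    (hN : 0 < N) (hm : m * N ≤ k) {δ c L : ℝ} (hδ : 0 ≤ δ) (hc : 0 ≤ c) (hL : 0 ≤ L)
    (hcL : 8 * c ^ 2 * L < N) (hδ' : δ < 1 - (1 - 2⁻¹ ^ N) ^ m)
    {odom : (Fin k → ℝ≥0) → (Fin k → ℝ≥0) → EReal} {r : (Fin k → ℝ≥0) → ℝ}
    (hr : ∀ ε, r ε ≤ c * √((∑ i, (ε i : ℝ) ^ 2) * L))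
    (hodom : ∀ ε, odom ε 0 =
      ((∑ i, (ε i : ℝ) * ((Real.exp (ε i) - 1) / (Real.exp (ε i) + 1)) + r ε : ℝ) : EReal)) :
    ¬ IsValidOdometer 𝒳 n k δ odom := by
  obtain ⟨x₁, x₀, hx⟩ := exists_pair_ne 𝒳
  intro hvalid
  set e := blockEps N k
  set p := responses e false k
  have h1 := hvalid (responseAdversary ⟨0, hn⟩ x₀ x₁ e)
  rw [view_responseAdversary _ hx] at h1
  have h2 : p.toOuterMeasure (noRun N m)ᶜ ≤ ENNReal.ofReal δ := by
    refine le_trans ?_ h1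
    refine le_trans ?_ (PMF.toOuterMeasure_map_apply _ _ _).ge
    refine PMF.toOuterMeasure_mono _ ?_
    rintro h ⟨hrun, hsupp⟩
    have hlen : h.length = k := length_of_responses_ne_zero hsupp
    subst hlen
    have hex : ∃ j, j < m ∧ (h.drop (j * N)).take N = List.replicate N true := by
      simpa [noRun] using hrun
    classical
    obtain ⟨hjm, hj⟩ := Nat.find_spec hex
    -- The strategy stops at the first run, so the loss estimate applies to the least such block.
    have hmin : h ∈ noRun N (Nat.find hex) := fun i hi hi' =>
      Nat.find_min hex hi ⟨hi.trans hjm, hi'⟩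
    have hjlen : (Nat.find hex + 1) * N ≤ h.length := (Nat.mul_le_mul_right _ hjm).trans hm
    have hlt := sum_add_lt_lossSum hN hmin hj hjlen hc hL hcL
    refine (hodom _).trans_lt (lt_of_lt_of_eq (EReal.coe_lt_coe_iff.2 ?_)
      ((EReal.coe_abs _).symm.trans (congrArg (fun x : EReal => (x.abs : EReal))
        (loss_responseAdversary ⟨0, hn⟩ hx e rfl).symm)))
    refine lt_of_lt_of_le (lt_of_le_of_lt ?_ hlt) (le_abs_self _)
    rw [Finset.sum_range, Finset.sum_range]
    exact add_le_add_right (hr _) _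
  have h3 : p.toOuterMeasure (noRun N m) ≤ ENNReal.ofReal ((1 - 2⁻¹ ^ N) ^ m) := by
    have h4 := toOuterMeasure_responses_take e false (m * N) (k - m * N) (noRun N m)
    have h5 := toOuterMeasure_noRun_le e N m
    rw [Nat.add_sub_cancel' hm] at h4
    simp only [take_mem_noRun le_rfl] at h4
    refine (h4.trans_le h5).trans (le_of_eq ?_)
    have hq : (2⁻¹ : ℝ) ^ N ≤ 1 := pow_le_one₀ (by norm_num) (by norm_num)
    rw [ENNReal.ofReal_pow (by linarith), ENNReal.ofReal_sub _ (by positivity),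
      ENNReal.ofReal_pow (by norm_num), ENNReal.ofReal_inv_of_pos two_pos]
    norm_num
  have h6 := toOuterMeasure_union_of_disjoint p (disjoint_compl_right (a := noRun N m))
  rw [Set.union_compl_self, toOuterMeasure_univ] at h6
  have h7 := h6.trans_le (add_le_add h3 h2)
  have hq : (2⁻¹ : ℝ) ^ N ≤ 1 := pow_le_one₀ (by norm_num) (by norm_num)
  rw [← ENNReal.ofReal_add (pow_nonneg (by linarith) _) hδ, ENNReal.one_le_ofReal] at h7
  linarith

/-! ### Choice of the block length and the number of blocks -/

/-- Bernoulli's inequality gives (1 - q)ᵐ ≤ 1/(1 + mq). -/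
theorem lt_one_sub_pow {q δ : ℝ} {m : ℕ} (hq : 0 ≤ q) (hq' : q ≤ 1) (hδ : δ < 1 / 2)
    (h : 2 * δ < m * q) : δ < 1 - (1 - q) ^ m := by
  have h1 : (1 - q) ^ m * (1 + m * q) ≤ 1 := by
    calc (1 - q) ^ m * (1 + m * q) ≤ (1 - q) ^ m * (1 + q) ^ m :=
          mul_le_mul_of_nonneg_left (one_add_mul_le_pow (by linarith) m)
            (pow_nonneg (by linarith) _)
      _ = (1 - q ^ 2) ^ m := by rw [← mul_pow]; ring
      _ ≤ 1 := pow_le_one₀ (by nlinarith) (by nlinarith)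
  have h2 : 0 ≤ (1 - q) ^ m := pow_nonneg (by linarith) _
  have h3 : 0 ≤ (m : ℝ) * q := by positivity
  by_contra hcon
  push Not at hcon
  nlinarith

theorem half_mul_exp_neg_le {N : ℕ} {x : ℝ} (hx : 0 ≤ x) (h : N ≤ x + 1) :
    1 / 2 * Real.exp (-x) ≤ 2⁻¹ ^ N := by
  have h1 : (2⁻¹ : ℝ) ^ N = Real.exp (-(N * Real.log 2)) := by
    rw [Real.exp_neg, mul_comm, Real.exp_mul, Real.exp_log two_pos, Real.rpow_natCast, inv_pow]
  have h2 : (1 / 2 : ℝ) = Real.exp (-Real.log 2) := by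
    rw [Real.exp_neg, Real.exp_log two_pos, one_div]
  rw [h1, h2, ← Real.exp_add, Real.exp_le_exp]
  have h3 : Real.log 2 ≤ 1 := by linarith [Real.log_two_lt_d9]
  have h4 : 0 < Real.log 2 := Real.log_pos one_lt_two
  nlinarith

theorem eventually_mul_log_pow_le :
    ∀ᶠ n : ℕ in atTop, 6 * Real.log n ^ 3 ≤ n := by
  have h := (Real.isLittleO_pow_log_id_atTop (n := 3)).comp_tendsto tendsto_natCast_atTop_atTop
  filter_upwards [h.def (show (0 : ℝ) < 1 / 6 by norm_num)] with n hn
  simp only [Function.comp, id, Real.norm_eq_abs, Nat.abs_cast] at hn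
  linarith [le_abs_self (Real.log (n : ℝ) ^ 3)]

/-- The number `m` and the length `N` of blocks with which some block of `N` fair coins shows only
heads with probability above `δ`. -/
theorem exists_block_params {K : ℝ} (hK : 0 < K) : ∃ a : ℝ, 0 < a ∧ ∀ᶠ n : ℕ in atTop,
    ∀ k : ℕ, n ≤ k → ∀ δ : ℝ, 0 < δ → δ < 1 / 2 → Real.log (1 / δ) ≤ K * k →
      0 ≤ Real.log (Real.log n / δ) ∧ ∃ N m : ℕ, 0 < N ∧ m * N ≤ k ∧
        a * Real.log (Real.log n / δ) < N ∧ 2 * δ < m * 2⁻¹ ^ N := by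
  -- The bound 1/2 keeps 2⁻ᴺ large; 1/(3K) makes one block fit into k rounds when δ is very small.
  refine ⟨min (1 / 2) (1 / (3 * K)), by positivity, ?_⟩
  set a := min (1 / 2) (1 / (3 * K))
  have ha : 0 < a := by positivity
  have ha2 : a ≤ 1 / 2 := min_le_left _ _
  have haK : a * K ≤ 1 / 3 := by
    calc a * K ≤ 1 / (3 * K) * K := mul_le_mul_of_nonneg_right (min_le_right _ _) hK.le
      _ = 1 / 3 := by field_simp
  filter_upwards [eventually_mul_log_pow_le, eventually_ge_atTop 2,
    (Real.tendsto_log_atTop.comp tendsto_natCast_atTop_atTop).eventually_ge_atTop 17]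
    with n hn6 hn2 hn17 k hk δ hδ hδ2 hδK
  simp only [Function.comp] at hn17
  set x := Real.log n
  have hx0 : 0 < x := by linarith
  set l := Real.log x
  set d := Real.log (1 / δ)
  have hl : 0 ≤ l := Real.log_nonneg (by linarith)
  have hd : 0 ≤ d := Real.log_nonneg (by rw [le_div_iff₀ hδ]; linarith)
  have hlx : l ≤ x - 1 := Real.log_le_sub_one_of_pos hx0
  have hexpl : Real.exp l = x := Real.exp_log hx0
  have hexpd : Real.exp (-d) = δ := by
    rw [Real.exp_neg, Real.exp_log (by positivity)]; simp
  have hL : Real.log (x / δ) = l + d := by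
    rw [div_eq_mul_one_div, Real.log_mul hx0.ne' (by positivity)]
  rw [hL]
  refine ⟨by positivity, ⌊a * (l + d)⌋₊ + 1, ?_⟩
  set N := ⌊a * (l + d)⌋₊ + 1
  have hN0 : 0 < N := Nat.succ_pos _
  have hNgt : a * (l + d) < N := by
    have := Nat.lt_floor_add_one (a * (l + d)); push_cast [N]; exact this
  have hNle : (N : ℝ) ≤ a * (l + d) + 1 := by
    have := Nat.floor_le (show 0 ≤ a * (l + d) by positivity)
    push_cast [N]; linarith
  have hk2 : (2 : ℝ) ≤ k := by exact_mod_cast hn2.trans hk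
  have hnk : (n : ℝ) ≤ k := by exact_mod_cast hk
  have h2N := half_mul_exp_neg_le (by positivity) hNle
  -- Here l = log log n and d = log(1/δ). If d ≥ 2l, a single block suffices, as a(l + d) ≤ 3d/4.
  -- Otherwise 2⁻ᴺ ≥ 1/(2 log² n), and as many blocks as fit are used.
  rcases le_or_gt (2 * l) d with hcase | hcase
  · refine ⟨1, hN0, ?_, hNgt, ?_⟩
    · rw [one_mul, ← Nat.cast_le (α := ℝ)]
      have h1 : a * (l + d) ≤ a * (3 / 2 * d) := mul_le_mul_of_nonneg_left (by linarith) ha.le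
      have h2 : a * d ≤ a * (K * k) := mul_le_mul_of_nonneg_left hδK ha.le
      have h3 : a * K * k ≤ 1 / 3 * k := mul_le_mul_of_nonneg_right haK (by linarith)
      nlinarith
    · rw [Nat.cast_one, one_mul]
      refine lt_of_lt_of_le ?_ h2N
      have h1 : a * (l + d) ≤ 3 / 4 * d := by nlinarith
      have h2 : Real.exp (-(3 / 4 * d)) ≤ Real.exp (-(a * (l + d))) :=
        Real.exp_le_exp.2 (by linarith)
      have h3 : Real.exp (-(3 / 4 * d)) = δ * Real.exp (d / 4) := by
        rw [← hexpd, ← Real.exp_add]; ring_nf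
      have h4 : 4 < Real.exp (d / 4) := by
        have h5 : Real.exp (l / 2) ≤ Real.exp (d / 4) := Real.exp_le_exp.2 (by linarith)
        have h6 : Real.exp (l / 2) ^ 2 = x := by
          rw [← hexpl, ← Real.exp_nat_mul]; ring_nf
        -- The square of the right side is log n ≥ 17 > 16.
        have h7 : 4 < Real.exp (l / 2) := by
          nlinarith [Real.exp_pos (l / 2)]
        linarith
      nlinarith
  · refine ⟨k / N, hN0, Nat.div_mul_le_self k N, hNgt, ?_⟩
    have hNx : (N : ℝ) ≤ 2 * x := by nlinarith
    have hdiv : (k : ℝ) < (k / N : ℕ) * N + N := by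
      have := Nat.lt_div_mul_add (a := k) hN0
      exact_mod_cast this
    have hm : 2 * x ^ 2 < (k / N : ℕ) := by
      have hm0 : (0 : ℝ) ≤ (k / N : ℕ) := Nat.cast_nonneg _
      have h1 : (k : ℝ) < ((k / N : ℕ) + 1) * (2 * x) := by nlinarith
      -- With x = log n, at most 2x² blocks would give k < (2x² + 1)·2x ≤ 6x³ ≤ n.
      by_contra hcon
      push Not at hcon
      nlinarith
    have hq : 1 / 2 * (1 / x ^ 2) ≤ 2⁻¹ ^ N := by
      refine le_trans ?_ h2N
      have h1 : Real.exp (-(2 * l)) = 1 / x ^ 2 := by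
        rw [Real.exp_neg, two_mul, Real.exp_add, hexpl, sq, one_div]
      rw [← h1]
      exact mul_le_mul_of_nonneg_left (Real.exp_le_exp.2 (by nlinarith)) (by norm_num)
    have h5 : (1 : ℝ) < (k / N : ℕ) * (1 / 2 * (1 / x ^ 2)) := by
      have : ((k / N : ℕ) : ℝ) * (1 / 2 * (1 / x ^ 2)) = (k / N : ℕ) / (2 * x ^ 2) := by
        field_simp
      rw [this, one_lt_div (by positivity)]
      exact hm
    have h6 := mul_le_mul_of_nonneg_left hq (Nat.cast_nonneg (α := ℝ) (k / N))
    linarith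

end AdaptivePrivacy

end

theorem mainTheorem3 :
    ∃ δ₀ : ℝ, 0 < δ₀ ∧
      ∀ (𝒳 : Type*) [Nontrivial 𝒳]
        (k : ℕ → ℕ) (_ : ∀ n, n ≤ k n)
        (δg : ℕ → ℝ) (_ : ∀ n, 0 < δg n ∧ δg n < δ₀)
        (_ : (fun n => Real.log (1 / δg n)) =O[atTop] fun n => (k n : ℝ))
        (odom : (n : ℕ) → (Fin (k n) → ℝ≥0) → (Fin (k n) → ℝ≥0) → EReal)
        (rem : (n : ℕ) → (Fin (k n) → ℝ≥0) → ℝ)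
        (_ : (fun p : (n : ℕ) × (Fin (k n) → ℝ≥0) => rem p.1 p.2)
          =o[comap (fun p : (n : ℕ) × (Fin (k n) → ℝ≥0) => p.1) atTop]
            fun p : (n : ℕ) × (Fin (k n) → ℝ≥0) =>
              Real.sqrt ((∑ i, (p.2 i : ℝ) ^ 2) * Real.log (Real.log (p.1 : ℝ) / δg p.1)))
        (_ : ∀ (n : ℕ) (ε : Fin (k n) → ℝ≥0),
          odom n ε 0 =
            ((∑ i, (ε i : ℝ) * ((Real.exp (ε i) - 1) / (Real.exp (ε i) + 1)) + rem n ε : ℝ) :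
              EReal)),
        ∀ᶠ n in atTop, ¬ AdaptivePrivacy.IsValidOdometer 𝒳 n (k n) (δg n) (odom n) := by
  refine ⟨1 / 2, by norm_num, fun 𝒳 _ k hk δg hδ hO odom rem hrem hodom => ?_⟩
  obtain ⟨K, hK, hKO⟩ := hO.exists_pos
  obtain ⟨a, ha, hparams⟩ := AdaptivePrivacy.exists_block_params hK
  -- For c = √(a/8) the requirement 8c²L < N becomes aL < N, which the block length satisfies.
  have hc : 0 < √(a / 8) := Real.sqrt_pos.2 (by positivity)
  filter_upwards [hparams, hKO.bound, eventually_comap.1 (hrem.def hc), eventually_gt_atTop 0]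
    with n hn hKn hremn hn0
  rw [Real.norm_eq_abs, Real.norm_eq_abs, Nat.abs_cast] at hKn
  obtain ⟨hL, N, m, hN, hm, haN, hmδ⟩ := hn (k n) (hk n) (δg n) (hδ n).1 (hδ n).2
    ((le_abs_self _).trans hKn)
  refine AdaptivePrivacy.not_isValidOdometer_of_run hn0 hN hm (hδ n).1.le hc.le hL ?_
    (AdaptivePrivacy.lt_one_sub_pow (by positivity)
      (pow_le_one₀ (by norm_num) (by norm_num)) (hδ n).2 hmδ) (r := rem n) ?_ (hodom n)
  · rw [Real.sq_sqrt (by positivity)]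
    linarith
  · intro ε
    have h := hremn ⟨n, ε⟩ rfl
    rw [Real.norm_eq_abs, Real.norm_eq_abs, abs_of_nonneg (Real.sqrt_nonneg _)] at h
    exact (le_abs_self _).trans h
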